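/- A numerical semigroup is a set \(S\subseteq\mathbb{Z}_{\ge 0}\) that contains \(0\), is closed under addition, and has finite complement in \(\mathbb{Z}_{\ge 0}\). Its embedding dimension is the cardinality of its unique minimal generating set, and its numerical semigroup polynomial is \(P_S(x)=(1-x)\sum_{s\in S}x^s\). The semigroup \(S\) is called symmetric if \(P_S(x)=x^kP_S(x^{-1})\) for some integer \(k\ge 0\), and cyclotomic if every complex root of \(P_S\) lies on the unit circle. For integers \(t\ge 0\) and \(n\ge 6t+2\), let \(S_{n,t}\) be the set of all finite sums (including the empty sum \(0\)) of elements of the following list: - \(n-2t+4i\) and \(n-2t+4i+1\) for \(0\le i\le t-1\); - the integers \(n+2t,\,n+2t+1,\,\ldots,\,2n-4t-2\); - \(2n-4t+4j-1\) for \(0\le j\le t-1\). **Theorem 1.** Let \(t\ge 0\) be an integer and let \(n\ge\max\bigl(8(t+1)^3,\,40(t+2)\bigr)\) be an integer. Then \(S_{n,t}\) is a numerical semigroup of embedding dimension \(n-3t-1\); it is symmetric but not cyclotomic, and in particular \(P_{S_{n,t}}\) is not a product of cyclotomic polynomials. -/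

import Mathlib

open scoped Polynomial PowerSeries LaurentPolynomial

/-- A numerical semigroup: a set of nonnegative integers that contains zero, is closed under
addition, and contains all but finitely many nonnegative integers. -/
structure NumericalSemigroup extends AddSubmonoid ℕ where
  finite_compl' : {m : ℕ | m ∉ carrier}.Finite

/-- The generators of `S_{n,t}`: the `t` pairs `n - 2t + 4i, n - 2t + 4i + 1` (`0 ≤ i ≤ t - 1`),
the integers `n + 2t, …, 2n - 4t - 2`, and the `t` integers `2n - 4t + 4j - 1` (`0 ≤ j ≤ t - 1`).
They are used only for `n ≥ 6t + 2`, where no subtraction below is truncated. -/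
def generatorsS (n t : ℕ) : Set ℕ :=
  {m | ∃ i < t, m = n - 2 * t + 4 * i ∨ m = n - 2 * t + 4 * i + 1} ∪
  Set.Icc (n + 2 * t) (2 * n - 4 * t - 2) ∪
  {m | ∃ j < t, m = 2 * n - 4 * t + 4 * j - 1}

namespace NumericalSemigroup

/-- The minimal generators of `S`: the nonzero elements that are not a sum of two nonzero
elements of `S`. By `isLeast_minimalGenerators` this is the unique minimal generating set. -/
def minimalGenerators (S : NumericalSemigroup) : Set ℕ :=
  {a | a ∈ S.toAddSubmonoid ∧ a ≠ 0 ∧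
    ∀ b ∈ S.toAddSubmonoid, ∀ c ∈ S.toAddSubmonoid, b ≠ 0 → c ≠ 0 → a ≠ b + c}

/-- `minimalGenerators S` generates `S` and is contained in every generating set of `S`. -/
theorem isLeast_minimalGenerators (S : NumericalSemigroup) :
    IsLeast {A : Set ℕ | AddSubmonoid.closure A = S.toAddSubmonoid} S.minimalGenerators := by
  constructor
  · refine le_antisymm ((AddSubmonoid.closure_le).2 fun a ha => ha.1) ?_
    intro m
    induction m using Nat.strong_induction_on with
    | _ m ih =>
      intro hm
      by_cases h0 : m = 0
      · subst h0; exact zero_mem _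
      by_cases hmin : m ∈ S.minimalGenerators
      · exact AddSubmonoid.subset_closure hmin
      · simp only [minimalGenerators, Set.mem_ofPred_eq, not_and, not_forall, not_not] at hmin
        obtain ⟨b, hb, c, hc, hb0, hc0, rfl⟩ := hmin hm h0
        exact add_mem (ih b (by omega) hb) (ih c (by omega) hc)
  · intro A hA a ha
    obtain ⟨haS, ha0, hirr⟩ := ha
    have hA' : AddSubmonoid.closure A = S.toAddSubmonoid := hA
    have key : ∀ x ∈ AddSubmonoid.closure A, x = a → a ∈ A := by
      intro x hx
      induction hx using AddSubmonoid.closure_induction with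
      | mem x hx => rintro rfl; exact hx
      | zero => intro h; exact absurd h.symm ha0
      | add x y hx hy ihx ihy =>
        intro h
        by_cases hx0 : x = 0
        · exact ihy (by omega)
        by_cases hy0 : y = 0
        · exact ihx (by omega)
        exact absurd h.symm (hirr x (hA' ▸ hx) y (hA' ▸ hy) hx0 hy0)
    exact key a (hA' ▸ haS) rfl

/-- The embedding dimension of `S`: the number of its minimal generators. -/
noncomputable def embeddingDimension (S : NumericalSemigroup) : ℕ :=
  S.minimalGenerators.ncard

open Classical in
/-- The Hilbert series `H_S(x) = ∑_{s ∈ S} x^s`, a formal power series. -/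
noncomputable def hilbertSeries (S : NumericalSemigroup) : ℤ⟦X⟧ :=
  PowerSeries.mk fun m => if m ∈ S.toAddSubmonoid then 1 else 0

/-- `(1 - x) H_S(x)` is a polynomial. -/
theorem exists_polynomial (S : NumericalSemigroup) :
    ∃ P : ℤ[X], (P : ℤ⟦X⟧) = (1 - PowerSeries.X) * S.hilbertSeries := by
  classical
  have hfin : {m : ℕ | m ∉ S.toAddSubmonoid}.Finite := S.finite_compl'
  set G : ℤ[X] := ∑ g ∈ hfin.toFinset, Polynomial.X ^ g with hG
  have hsum : S.hilbertSeries + (G : ℤ⟦X⟧) = PowerSeries.mk 1 := by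
    ext m
    by_cases hm : m ∈ S.toAddSubmonoid <;>
      simp [hilbertSeries, hG, Polynomial.coeff_X_pow, hm]
  have h1 := PowerSeries.mk_one_mul_one_sub_eq_one ℤ
  refine ⟨1 - (1 - Polynomial.X) * G, ?_⟩
  push_cast
  rw [← hsum] at h1
  linear_combination -h1

/-- The numerical semigroup polynomial `P_S(x) = (1 - x) H_S(x)`. -/
noncomputable def polynomial (S : NumericalSemigroup) : ℤ[X] :=
  S.exists_polynomial.choose

theorem coe_polynomial (S : NumericalSemigroup) :
    (S.polynomial : ℤ⟦X⟧) = (1 - PowerSeries.X) * S.hilbertSeries :=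
  S.exists_polynomial.choose_spec

/-- `S` is symmetric: `P_S(x) = x^k P_S(x⁻¹)` for some nonnegative integer `k`, as an identity of
Laurent polynomials. -/
def IsSymmetric (S : NumericalSemigroup) : Prop :=
  ∃ k : ℕ, Polynomial.toLaurent S.polynomial =
    LaurentPolynomial.T (k : ℤ) * LaurentPolynomial.invert (Polynomial.toLaurent S.polynomial)

/-- `S` is cyclotomic: every complex root of `P_S` lies on the unit circle. -/
def IsCyclotomic (S : NumericalSemigroup) : Prop :=
  ∀ z : ℂ, Polynomial.aeval z S.polynomial = 0 → ‖z‖ = 1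

end NumericalSemigroup

/-! `S` has largest gap `2n - 1`, and `s ↦ 2n - 1 - s` swaps elements and gaps; hence symmetry. As
to the roots, `P = (1-x)(1-x^(2n-1)) + x^(n-2t)(1 - x^2 + ⋯ + x^(4t))`, so the top coefficients of
`P` are `1, -1, 0, …, 0`.

Suppose all roots lie on the unit circle. By Newton's identities their low power sums are all `1`,
so for low moments they look like uniform measure on the circle plus a point mass at `1`. Comparing
consecutive moments of `|1+z|²` forces a root close to `1` (`exists_norm_one_sub_sq_lt`). But at a
root, `(1+x²)P = 0` makes `1 + z^(4t+2)` of size `O(|1-z|)`, while it is near `2` when `z` is near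
`1` (`two_le_mul_norm_one_sub`). For `n` large against `t²` the two bounds conflict. -/

/-! ### Elements and minimal generators -/

/-- An explicit description of the elements of `S_{n,t}`. -/
def memS (n t k : ℕ) : Prop :=
  k = 0 ∨ (n - 2 * t ≤ k ∧ k < n + 2 * t ∧ (k - (n - 2 * t)) % 4 < 2) ∨
    (n + 2 * t ≤ k ∧ k ≠ 2 * n - 1)

/-- The semigroup `S_{n,t}`, given by the explicit list of its elements. -/
def semigroupS (n t : ℕ) (h : 6 * t + 3 ≤ n) : NumericalSemigroup where
  carrier := {k | memS n t k}
  zero_mem' := Or.inl rfl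
  add_mem' := by
    intro a b ha hb
    simp only [Set.mem_ofPred_eq, memS] at *
    -- Two window elements sum to residue 0, 1 or 2 mod 4 relative to `2n - 4t`, whereas `2n - 1`
    -- has residue 3; any sum with a summand at least `n + 2t` is `0 + s` or at least `2n`.
    omega
  finite_compl' := by
    refine (Set.finite_lt_nat (2 * n)).subset fun k hk => ?_
    simp only [Set.mem_ofPred_eq, memS] at *
    omega

section
variable {n t : ℕ} (h : 6 * t + 3 ≤ n)

theorem mem_semigroupS {k : ℕ} : k ∈ (semigroupS n t h).toAddSubmonoid ↔ memS n t k := Iff.rfl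

theorem mem_generatorsS {k : ℕ} : k ∈ generatorsS n t ↔
    (∃ i < t, k = n - 2 * t + 4 * i ∨ k = n - 2 * t + 4 * i + 1) ∨
    (n + 2 * t ≤ k ∧ k ≤ 2 * n - 4 * t - 2) ∨ ∃ j < t, k = 2 * n - 4 * t + 4 * j - 1 := by
  simp only [generatorsS, Set.mem_union, Set.mem_ofPred_eq, Set.mem_Icc, or_assoc]

end

/-- A sum of two nonzero elements is at least `2n - 4t`, and below `2n` both summands lie in the
window, so residue 3 mod 4 relative to `2n - 4t` is never reached. These unreachable values are the
last `t` generators. -/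
theorem minimalGenerators_semigroupS {n t : ℕ} (h : 6 * t + 3 ≤ n) :
    (semigroupS n t h).minimalGenerators = generatorsS n t := by
  ext k
  rw [mem_generatorsS]
  constructor
  · rintro ⟨hk, hk0, hirr⟩
    rw [mem_semigroupS] at hk
    have key : ∀ b c, memS n t b → memS n t c → b ≠ 0 → c ≠ 0 → k ≠ b + c :=
      fun b c hb hc => hirr b hb c hc
    by_contra hgen
    push Not at hgen
    obtain ⟨h1, h2, h3⟩ := hgen
    rcases hk with hk | hk | hk
    · exact hk0 hk
    · have := h1 ((k - (n - 2 * t)) / 4)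
      omega
    · by_cases hbig : 2 * n ≤ k
      -- Here subtracting `n - 2t` would leave the gap `2n - 1`.
      · by_cases hk' : k = 3 * n - 2 * t - 1
        · refine key (n - 2 * t + 1) (k - (n - 2 * t + 1)) ?_ ?_ ?_ ?_ ?_ <;>
            (try simp only [memS]) <;> omega
        · refine key (n - 2 * t) (k - (n - 2 * t)) ?_ ?_ ?_ ?_ ?_ <;>
            (try simp only [memS]) <;> omega
      · have h2' := h2 hk.1
        have h3' := h3 ((k + 1 - (2 * n - 4 * t)) / 4)
        -- Residue 3 is either a listed generator or `2n - 1`. A residue `r ≤ 2` splits as `(r+1)/2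
        -- + r/2`, each part 0 or 1, giving one element from each of two pairs.
        obtain ⟨q, r, hr, hkq⟩ : ∃ q r, r < 3 ∧ k = 2 * n - 4 * t + 4 * q + r :=
          ⟨(k - (2 * n - 4 * t)) / 4, (k - (2 * n - 4 * t)) % 4, by omega, by omega⟩
        refine key (n - 2 * t + (r + 1) / 2) (n - 2 * t + 4 * q + r / 2) ?_ ?_ ?_ ?_ ?_ <;>
            (try simp only [memS]) <;> omega
  · intro hk
    refine ⟨?_, ?_, ?_⟩
    · rw [mem_semigroupS, memS]
      rcases hk with ⟨i, hi, hk⟩ | hk | ⟨i, hi, hk⟩ <;> omega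
    · rcases hk with ⟨i, hi, hk⟩ | hk | ⟨i, hi, hk⟩ <;> omega
    · intro b hb c hc hb0 hc0
      rw [mem_semigroupS, memS] at hb hc
      rcases hk with ⟨i, hi, hk⟩ | hk | ⟨i, hi, hk⟩ <;> omega

theorem ncard_generatorsS {n t : ℕ} (h : 6 * t + 3 ≤ n) :
    (generatorsS n t).ncard = n - 3 * t - 1 := by
  classical
  have heq : generatorsS n t = (((Finset.range t).image (fun i => n - 2 * t + 4 * i) ∪
      (Finset.range t).image (fun i => n - 2 * t + 4 * i + 1)) ∪
      (Finset.Icc (n + 2 * t) (2 * n - 4 * t - 2) ∪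
      (Finset.range t).image (fun j => 2 * n - 4 * t + 4 * j - 1)) : Finset ℕ) := by
    ext k
    rw [mem_generatorsS]
    simp only [Finset.coe_union, Set.mem_union, Finset.mem_coe, Finset.mem_image,
      Finset.mem_range, Finset.mem_Icc]
    constructor
    · rintro (⟨i, hi, hk | hk⟩ | hk | ⟨i, hi, hk⟩)
      · exact Or.inl (Or.inl ⟨i, hi, hk.symm⟩)
      · exact Or.inl (Or.inr ⟨i, hi, hk.symm⟩)
      · exact Or.inr (Or.inl hk)
      · exact Or.inr (Or.inr ⟨i, hi, hk.symm⟩)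
    · rintro ((⟨i, hi, hk⟩ | ⟨i, hi, hk⟩) | hk | ⟨i, hi, hk⟩)
      · exact Or.inl ⟨i, hi, Or.inl hk.symm⟩
      · exact Or.inl ⟨i, hi, Or.inr hk.symm⟩
      · exact Or.inr (Or.inl hk)
      · exact Or.inr (Or.inr ⟨i, hi, hk.symm⟩)
  rw [heq, Set.ncard_coe_finset, Finset.card_union_of_disjoint, Finset.card_union_of_disjoint,
    Finset.card_union_of_disjoint, Finset.card_image_of_injective, Finset.card_image_of_injective,
    Finset.card_image_of_injOn, Finset.card_range, Nat.card_Icc]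
  · omega
  · intro a _ b _ hab
    simp only at hab
    omega
  · intro a b hab
    simp only at hab
    omega
  · intro a b hab
    simp only at hab
    omega
  all_goals
    rw [Finset.disjoint_left]
    simp only [Finset.mem_union, Finset.mem_image, Finset.mem_range, Finset.mem_Icc]
  · rintro a ha ⟨j, hj, rfl⟩
    omega
  · rintro a ⟨i, hi, rfl⟩ ⟨j, hj, hk⟩
    omega
  · rintro a (⟨i, hi, rfl⟩ | ⟨i, hi, rfl⟩) (ha | ⟨j, hj, hk⟩) <;> omega

/-! ### The semigroup polynomial and its symmetry -/

open Classical in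
theorem NumericalSemigroup.coeff_polynomial_zero (S : NumericalSemigroup) :
    S.polynomial.coeff 0 = 1 := by
  rw [← Polynomial.coeff_coe, S.coe_polynomial, sub_mul, one_mul, map_sub,
    PowerSeries.coeff_zero_X_mul]
  simp [NumericalSemigroup.hilbertSeries]

open Classical in
theorem NumericalSemigroup.coeff_polynomial_succ (S : NumericalSemigroup) (k : ℕ) :
    S.polynomial.coeff (k + 1) = (if k + 1 ∈ S.toAddSubmonoid then 1 else 0) -
      (if k ∈ S.toAddSubmonoid then 1 else 0) := by
  rw [← Polynomial.coeff_coe, S.coe_polynomial, sub_mul, one_mul, map_sub,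
    PowerSeries.coeff_succ_X_mul]
  simp [NumericalSemigroup.hilbertSeries]

/-- A polynomial whose coefficients form a palindrome of length `k + 1` equals `x^k P(x⁻¹)`. -/
theorem toLaurent_eq_T_mul_invert {P : ℤ[X]} {k : ℕ} (hdeg : ∀ i, k < i → P.coeff i = 0)
    (hpal : ∀ i ≤ k, P.coeff (k - i) = P.coeff i) :
    Polynomial.toLaurent P =
      LaurentPolynomial.T (k : ℤ) * LaurentPolynomial.invert (Polynomial.toLaurent P) := by
  have hle : P.natDegree ≤ k := Polynomial.natDegree_le_iff_coeff_eq_zero.2 hdeg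
  have hsum := P.as_sum_range' (k + 1) (by omega)
  have hL : Polynomial.toLaurent P = ∑ i ∈ Finset.range (k + 1),
      LaurentPolynomial.C (P.coeff i) * LaurentPolynomial.T (i : ℤ) := by
    conv_lhs => rw [hsum]
    simp [map_sum, Polynomial.toLaurent_C_mul_T]
  conv_lhs => rw [hL, ← Finset.sum_range_reflect]
  rw [hL, map_sum, Finset.mul_sum]
  refine Finset.sum_congr rfl fun i hi => ?_
  have hi' : i ≤ k := by simpa [Nat.lt_succ_iff] using hi
  rw [map_mul, LaurentPolynomial.invert_C, LaurentPolynomial.invert_T, mul_left_comm,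
    ← LaurentPolynomial.T_add, show k + 1 - 1 - i = k - i by omega, hpal i hi',
    Nat.cast_sub hi', sub_eq_add_neg]

section
variable {n t : ℕ} (h : 6 * t + 3 ≤ n)

open Classical in
theorem coeff_polynomial_semigroupS_succ (k : ℕ) :
    (semigroupS n t h).polynomial.coeff (k + 1) =
      (if memS n t (k + 1) then 1 else 0) - (if memS n t k then 1 else 0) := by
  rw [NumericalSemigroup.coeff_polynomial_succ]
  rfl

/-- The reflection `k ↦ 2n - 1 - k` maps the window to itself, exchanging residues 0, 1 with 3, 2,
and so exchanges elements and gaps. -/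
theorem isSymmetric_semigroupS : (semigroupS n t h).IsSymmetric := by
  classical
  refine ⟨2 * n, toLaurent_eq_T_mul_invert ?_ ?_⟩
  · intro i hi
    obtain ⟨k, rfl⟩ : ∃ k, i = k + 1 := ⟨i - 1, by omega⟩
    rw [coeff_polynomial_semigroupS_succ, if_pos, if_pos, sub_self] <;> simp only [memS] <;> omega
  · intro i hi
    obtain rfl | ⟨k, rfl⟩ : i = 0 ∨ ∃ k, i = k + 1 := by
      rcases i with _ | k
      · exact Or.inl rfl
      · exact Or.inr ⟨k, rfl⟩
    · obtain ⟨l, hl⟩ : ∃ l, 2 * n - 0 = l + 1 := ⟨2 * n - 1, by omega⟩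
      rw [hl, coeff_polynomial_semigroupS_succ, NumericalSemigroup.coeff_polynomial_zero,
        if_pos, if_neg, sub_zero] <;> simp only [memS] <;> omega
    · by_cases hk : k + 1 = 2 * n
      · rw [hk, Nat.sub_self, NumericalSemigroup.coeff_polynomial_zero, ← hk,
          coeff_polynomial_semigroupS_succ, if_pos, if_neg, sub_zero] <;> simp only [memS] <;> omega
      · obtain ⟨l, hl⟩ : ∃ l, 2 * n - (k + 1) = l + 1 := ⟨2 * n - k - 2, by omega⟩
        have h1 : memS n t (l + 1) ↔ ¬ memS n t k := by simp only [memS]; omega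
        have h2 : memS n t l ↔ ¬ memS n t (k + 1) := by simp only [memS]; omega
        rw [hl, coeff_polynomial_semigroupS_succ, coeff_polynomial_semigroupS_succ]
        simp only [h1, h2]
        split_ifs <;> simp

theorem natDegree_polynomial_semigroupS : (semigroupS n t h).polynomial.natDegree = 2 * n := by
  classical
  refine le_antisymm (Polynomial.natDegree_le_iff_coeff_eq_zero.2 fun i hi => ?_)
    (Polynomial.le_natDegree_of_ne_zero ?_)
  · obtain ⟨k, rfl⟩ : ∃ k, i = k + 1 := ⟨i - 1, by omega⟩
    rw [coeff_polynomial_semigroupS_succ, if_pos, if_pos, sub_self] <;> simp only [memS] <;> omega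
  · obtain ⟨l, hl⟩ : ∃ l, 2 * n = l + 1 := ⟨2 * n - 1, by omega⟩
    rw [hl, coeff_polynomial_semigroupS_succ, if_pos, if_neg] <;> simp [memS] <;> omega

theorem monic_polynomial_semigroupS : (semigroupS n t h).polynomial.Monic := by
  classical
  rw [Polynomial.Monic, Polynomial.leadingCoeff, natDegree_polynomial_semigroupS]
  obtain ⟨l, hl⟩ : ∃ l, 2 * n = l + 1 := ⟨2 * n - 1, by omega⟩
  rw [hl, coeff_polynomial_semigroupS_succ, if_pos, if_neg] <;> simp [memS] <;> omega

theorem coeff_polynomial_semigroupS_two_mul_sub_one :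
    (semigroupS n t h).polynomial.coeff (2 * n - 1) = -1 := by
  classical
  obtain ⟨l, hl⟩ : ∃ l, 2 * n - 1 = l + 1 := ⟨2 * n - 2, by omega⟩
  rw [hl, coeff_polynomial_semigroupS_succ, if_neg, if_pos] <;> simp [memS] <;> omega

/-- There are no gaps from `n + 2t` to `2n - 2`. Through Vieta, this kills the elementary symmetric
functions of the roots in degrees 2 to `n - 2t - 1`. -/
theorem coeff_polynomial_semigroupS_two_mul_sub {k : ℕ} (hk : 2 ≤ k) (hk' : k < n - 2 * t) :
    (semigroupS n t h).polynomial.coeff (2 * n - k) = 0 := by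
  classical
  obtain ⟨l, hl⟩ : ∃ l, 2 * n - k = l + 1 := ⟨2 * n - k - 1, by omega⟩
  rw [hl, coeff_polynomial_semigroupS_succ, if_pos, if_pos, sub_self] <;> simp only [memS] <;> omega

set_option maxHeartbeats 1000000 in
open Classical in
/-- Away from the coefficients of `(1 - x)(1 - x^(2n-1))` at both ends, the coefficients of
`P_{S_{n,t}}` are alternately `1` and `-1` at every second degree of a window around `n`. -/
theorem coeff_polynomial_semigroupS_sub (k : ℕ) :
    ((semigroupS n t h).polynomial -
      (1 - Polynomial.X) * (1 - Polynomial.X ^ (2 * n - 1))).coeff k =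
      if n - 2 * t ≤ k ∧ k ≤ n + 2 * t ∧ (k - (n - 2 * t)) % 4 = 0 then 1
      else if n - 2 * t ≤ k ∧ k ≤ n + 2 * t ∧ (k - (n - 2 * t)) % 4 = 2 then -1 else 0 := by
  obtain ⟨l, hl⟩ : ∃ l, 2 * n = l + 1 := ⟨2 * n - 1, by omega⟩
  have hE : (1 - Polynomial.X) * (1 - Polynomial.X ^ (2 * n - 1)) =
      1 - Polynomial.X ^ 1 - Polynomial.X ^ (2 * n - 1) + (Polynomial.X ^ (2 * n) : ℤ[X]) := by
    rw [hl, show l + 1 - 1 = l by omega]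
    ring
  rw [hE]
  simp only [Polynomial.coeff_add, Polynomial.coeff_sub, Polynomial.coeff_X_pow,
    Polynomial.coeff_one]
  rcases k with _ | k
  · rw [NumericalSemigroup.coeff_polynomial_zero]
    split_ifs <;> first | contradiction | omega
  · rw [coeff_polynomial_semigroupS_succ]
    by_cases h1 : memS n t (k + 1) <;> by_cases h2 : memS n t k <;>
      simp only [h1, h2, if_true, if_false] <;> simp only [memS] at h1 h2 <;>
      split_ifs <;> first | contradiction | omega

/-- The factor `1 + x²` telescopes the alternating sum in the window, leaving only its two ends. -/
theorem polynomial_semigroupS_mul : (1 + Polynomial.X ^ 2) * (semigroupS n t h).polynomial =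
    (1 + Polynomial.X ^ 2) * ((1 - Polynomial.X) * (1 - Polynomial.X ^ (2 * n - 1))) +
      Polynomial.X ^ (n - 2 * t) * (1 + Polynomial.X ^ (4 * t + 2)) := by
  rw [← sub_eq_iff_eq_add', ← mul_sub, mul_add, mul_one, ← pow_add,
    show n - 2 * t + (4 * t + 2) = n + 2 * t + 2 by omega]
  ext k
  rw [add_mul, one_mul, Polynomial.coeff_add, Polynomial.coeff_add, Polynomial.coeff_X_pow,
    Polynomial.coeff_X_pow, coeff_polynomial_semigroupS_sub, Polynomial.coeff_X_pow_mul',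
    coeff_polynomial_semigroupS_sub]
  split_ifs <;> omega

end

/-! ### Power sums and a root near 1 -/

/-- If the elementary symmetric functions of `z` are `1` in degree `1` and `0` in the degrees from
`2` to `m - 1`, then the power sums of `z` are `1` in all degrees from `1` to `m - 1`. -/
theorem sum_pow_eq_one_of_esymm {σ R : Type*} [Fintype σ] [CommRing R] (z : σ → R) {m : ℕ}
    (h1 : MvPolynomial.aeval z (MvPolynomial.esymm σ R 1) = 1)
    (h0 : ∀ k, 2 ≤ k → k < m → MvPolynomial.aeval z (MvPolynomial.esymm σ R k) = 0)
    {k : ℕ} (hk : 1 ≤ k) (hkm : k < m) : ∑ j, z j ^ k = 1 := by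
  classical
  have hp (k : ℕ) : ∑ j, z j ^ k = MvPolynomial.aeval z (MvPolynomial.psum σ R k) := by
    simp [MvPolynomial.psum]
  induction k, hk using Nat.le_induction with
  | base => simpa [MvPolynomial.esymm_one, map_sum] using h1
  | succ k hk ih =>
    -- In Newton's identity only the term with `e₁ = 1` survives, so each power sum equals the
    -- previous one.
    rw [hp, MvPolynomial.psum_eq_mul_esymm_sub_sum σ R (k + 1) (by omega), map_sub, map_sum,
      map_mul, h0 (k + 1) (by omega) hkm, mul_zero, zero_sub,
      Finset.sum_eq_single (1, k)]
    · rw [map_mul, map_mul, ← hp, ih (by omega), h1]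
      simp
    · rintro ⟨a, b⟩ hab hne
      simp only [Finset.mem_filter, Finset.HasAntidiagonal.mem_antidiagonal, Set.mem_Ioo] at hab
      have ha : a ≠ 1 := by
        rintro rfl
        exact hne (by rw [Prod.mk.injEq]; omega)
      rw [map_mul, map_mul, h0 a (by omega) (by omega)]
      simp
    · intro hnot
      refine absurd ?_ hnot
      simp only [Finset.mem_filter, Finset.HasAntidiagonal.mem_antidiagonal, Set.mem_Ioo]
      omega

/-- The moments of `|1 + z|²` over a finite family of points of the unit circle whose power sums
are `1` in all degrees from `1` to `N`. -/
theorem sum_norm_one_add_sq_pow {σ : Type*} [Fintype σ] (z : σ → ℂ) (hz : ∀ j, ‖z j‖ = 1) {N : ℕ}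
    (hp : ∀ k, 1 ≤ k → k ≤ N → ∑ j, z j ^ k = 1) :
    ∑ j, (‖1 + z j‖ ^ 2) ^ N = ((Fintype.card σ : ℝ) - 1) * N.centralBinom + 4 ^ N := by
  have hz0 (j : σ) : z j ≠ 0 := fun h => by simpa [h] using hz j
  have hconj (j : σ) : (starRingEnd ℂ) (z j) = (z j)⁻¹ := by
    rw [Complex.inv_def, Complex.normSq_eq_norm_sq, hz j]; simp
  -- The summand is `z^(k-N)`; negative exponents are conjugates of positive ones on the circle.
  have hq (k : ℕ) (hk : k ≤ 2 * N) : ∑ j, z j ^ k * ((z j)⁻¹) ^ N =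
      1 + if k = N then (Fintype.card σ : ℂ) - 1 else 0 := by
    rcases lt_trichotomy k N with h | h | h
    · rw [if_neg h.ne, add_zero]
      have hs := congrArg (starRingEnd ℂ) (hp (N - k) (by omega) (by omega))
      rw [map_sum, map_one] at hs
      rw [← hs]
      refine Finset.sum_congr rfl fun j _ => ?_
      rw [map_pow, hconj]
      obtain ⟨d, rfl⟩ := Nat.exists_eq_add_of_lt h
      rw [show k + d + 1 - k = d + 1 by omega, add_assoc, pow_add, ← mul_assoc, ← mul_pow,
        mul_inv_cancel₀ (hz0 j), one_pow, one_mul]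
    · subst h
      simp only [← mul_pow, mul_inv_cancel₀ (hz0 _)]
      simp
    · rw [if_neg h.ne', add_zero, ← hp (k - N) (by omega) (by omega)]
      refine Finset.sum_congr rfl fun j _ => ?_
      obtain ⟨d, rfl⟩ := Nat.exists_eq_add_of_lt h
      rw [show N + d + 1 - N = d + 1 by omega, add_assoc, pow_add, mul_right_comm, ← mul_pow,
        mul_inv_cancel₀ (hz0 j), one_pow, one_mul]
  -- On the circle `|1+z|² = (1+z)²/z`, so its powers expand binomially.
  have hy (j : σ) : (((‖1 + z j‖ ^ 2) ^ N : ℝ) : ℂ) =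
      ∑ k ∈ Finset.range (2 * N + 1), ((2 * N).choose k : ℂ) * (z j ^ k * ((z j)⁻¹) ^ N) := by
    have h1 : (((‖1 + z j‖ ^ 2 : ℝ)) : ℂ) = (1 + z j) ^ 2 * (z j)⁻¹ := by
      rw [← Complex.normSq_eq_norm_sq, ← Complex.mul_conj, map_add, map_one, hconj]
      field_simp [hz0 j]
      ring
    rw [Complex.ofReal_pow, h1, mul_pow, ← pow_mul, add_comm, add_pow, Finset.sum_mul]
    refine Finset.sum_congr rfl fun k _ => ?_
    rw [one_pow]
    ring
  have hmain : ((∑ j, (‖1 + z j‖ ^ 2) ^ N : ℝ) : ℂ) =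
      (((Fintype.card σ : ℝ) - 1) * N.centralBinom + 4 ^ N : ℝ) := by
    rw [Complex.ofReal_sum, Finset.sum_congr rfl fun j _ => hy j, Finset.sum_comm]
    simp only [← Finset.mul_sum]
    rw [Finset.sum_congr rfl fun k hk => by
      rw [hq k (by simpa [Nat.lt_succ_iff] using hk), mul_add, mul_one, mul_ite, mul_zero],
      Finset.sum_add_distrib, Finset.sum_ite_eq', if_pos (by simp; omega), ← Nat.cast_sum,
      Nat.sum_range_choose, pow_mul]
    push_cast [Nat.centralBinom]
    ring
  exact_mod_cast hmain

/-- A family of points of the unit circle with power sums `1` in degrees `1, …, N + 1` cannot avoid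
the neighbourhood `|1 - z|² < 2 / (N + 1)` of the point `1`. -/
theorem exists_norm_one_sub_sq_lt {σ : Type*} [Fintype σ] (z : σ → ℂ) (hz : ∀ j, ‖z j‖ = 1)
    {N : ℕ} (hp : ∀ k, 1 ≤ k → k ≤ N + 1 → ∑ j, z j ^ k = 1) :
    ∃ j, ‖1 - z j‖ ^ 2 < 2 / (N + 1) := by
  by_contra! hcon
  have hY (j : σ) : ‖1 + z j‖ ^ 2 ≤ 4 - 2 / (N + 1) := by
    have := parallelogram_law_with_norm ℝ (1 : ℂ) (z j)
    rw [hz j, norm_one] at this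
    nlinarith [hcon j]
  have hle : ∑ j, (‖1 + z j‖ ^ 2) ^ (N + 1) ≤
      (4 - 2 / ((N : ℝ) + 1)) * ∑ j, (‖1 + z j‖ ^ 2) ^ N := by
    rw [Finset.mul_sum]
    refine Finset.sum_le_sum fun j _ => ?_
    rw [pow_succ']
    exact mul_le_mul_of_nonneg_right (hY j) (by positivity)
  rw [sum_norm_one_add_sq_pow z hz hp,
    sum_norm_one_add_sq_pow z hz fun k h1 h2 => hp k h1 (by omega)] at hle
  have hN : (0 : ℝ) < (N : ℝ) + 1 := by positivity
  -- Central binomials grow by exactly the assumed ratio, so they cancel from `hle`; the point-mass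
  -- term grows by `4`, which is too fast.
  have hcb : ((N + 1).centralBinom : ℝ) = (4 - 2 / ((N : ℝ) + 1)) * N.centralBinom := by
    have := congrArg (Nat.cast : ℕ → ℝ) (Nat.succ_mul_centralBinom_succ N)
    push_cast at this
    field_simp
    linarith
  rw [hcb, pow_succ'] at hle
  have h4 : (0 : ℝ) < 2 / ((N : ℝ) + 1) * 4 ^ N := by positivity
  linarith

/-- Newton's identities concern an indexed family, so the multiset of roots is indexed, with
multiplicity. -/
theorem exists_roots_family (P : ℂ[X]) : ∃ z : Fin P.natDegree → ℂ,
    Finset.univ.val.map z = P.roots := by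
  have hcard : P.roots.card = P.natDegree := Polynomial.splits_iff_card_roots.1 (IsAlgClosed.splits P)
  refine ⟨fun i => P.roots.toList.get (i.cast (by simp [hcard])), ?_⟩
  rw [Fin.univ_val_map]
  conv_rhs => rw [← P.roots.coe_toList]
  congr 1
  refine List.ext_get (by simp [hcard]) fun i h1 h2 => by simp

/-- A point `z ≠ 1` of the unit circle with
`(1 + z²)(1 - z)(1 - z^a) + z^b (1 + z^c) = 0` has distance at least `2 / (c + 4)` from `1`. -/
theorem two_le_mul_norm_one_sub {z : ℂ} (hz : ‖z‖ = 1) {a b c : ℕ}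
    (h : (1 + z ^ 2) * ((1 - z) * (1 - z ^ a)) + z ^ b * (1 + z ^ c) = 0) :
    2 ≤ (c + 4) * ‖1 - z‖ := by
  have hpow (k : ℕ) : ‖z ^ k‖ = 1 := by rw [norm_pow, hz, one_pow]
  have h1 : ‖1 + z ^ c‖ ≤ 4 * ‖1 - z‖ := by
    have h2 : ‖1 + z ^ c‖ = ‖1 + z ^ 2‖ * (‖1 - z‖ * ‖1 - z ^ a‖) := by
      rw [← norm_mul, ← norm_mul, ← one_mul ‖1 + z ^ c‖, ← hpow b, ← norm_mul,
        eq_neg_of_add_eq_zero_left h, norm_neg]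
    have h3 : ‖1 + z ^ 2‖ ≤ 2 := (norm_add_le _ _).trans (by rw [hpow, norm_one]; norm_num)
    have h4 : ‖1 - z ^ a‖ ≤ 2 := (norm_sub_le _ _).trans (by rw [hpow, norm_one]; norm_num)
    rw [h2]
    calc ‖1 + z ^ 2‖ * (‖1 - z‖ * ‖1 - z ^ a‖) ≤ 2 * (‖1 - z‖ * 2) := by gcongr
      _ = 4 * ‖1 - z‖ := by ring
  have h5 (k : ℕ) : ‖1 - z ^ k‖ ≤ k * ‖1 - z‖ := by
    induction k with
    | zero => simp
    | succ k ih =>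
      calc ‖1 - z ^ (k + 1)‖ = ‖(1 - z ^ k) + z ^ k * (1 - z)‖ := by congr 1; ring
        _ ≤ ‖1 - z ^ k‖ + ‖z ^ k * (1 - z)‖ := norm_add_le _ _
        _ ≤ k * ‖1 - z‖ + ‖1 - z‖ := by
          rw [norm_mul, hpow, one_mul]
          gcongr
        _ = (k + 1 : ℕ) * ‖1 - z‖ := by push_cast; ring
  -- Since `2 = (1 + z^c) + (1 - z^c)`, one of the two terms must be large.
  have h6 : (2 : ℝ) ≤ ‖1 + z ^ c‖ + ‖1 - z ^ c‖ := by
    have := norm_add_le (1 + z ^ c) (1 - z ^ c)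
    rw [show 1 + z ^ c + (1 - z ^ c) = 2 by ring] at this
    simpa using this
  linarith [h5 c]

/-- If all roots of a monic `P` with coefficients `1, -1, 0, …, 0` in the `m` highest degrees lie on
the unit circle, then some root is close to `1`. -/
theorem exists_root_norm_one_sub_sq_lt {P : ℤ[X]} (hP : P.Monic)
    (hroot : ∀ z : ℂ, Polynomial.aeval z P = 0 → ‖z‖ = 1) {N : ℕ} (hN : N + 2 ≤ P.natDegree)
    (h1 : P.coeff (P.natDegree - 1) = -1)
    (h0 : ∀ k, 2 ≤ k → k < N + 2 → P.coeff (P.natDegree - k) = 0) :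
    ∃ z : ℂ, Polynomial.aeval z P = 0 ∧ ‖1 - z‖ ^ 2 < 2 / (N + 1) := by
  set Q : ℂ[X] := P.map (algebraMap ℤ ℂ) with hQ
  have hQm : Q.Monic := hP.map _
  have hdeg : Q.natDegree = P.natDegree := hP.natDegree_map _
  have hQroot {z : ℂ} (hz : z ∈ Q.roots) : Polynomial.aeval z P = 0 := by
    rw [← Polynomial.eval_map_algebraMap]
    exact (Polynomial.mem_roots'.1 hz).2
  obtain ⟨z, hz⟩ := exists_roots_family Q
  have hmem (j) : z j ∈ Q.roots := hz ▸ Multiset.mem_map_of_mem z (Finset.mem_univ_val j)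
  have hesymm (k : ℕ) (hk : k ≤ P.natDegree) :
      ((P.coeff (P.natDegree - k) : ℤ) : ℂ) = (-1) ^ k *
        MvPolynomial.aeval z (MvPolynomial.esymm (Fin Q.natDegree) ℂ k) := by
    have := Polynomial.coeff_eq_esymm_roots_of_card
      (Polynomial.splits_iff_card_roots.1 (IsAlgClosed.splits Q))
      (k := P.natDegree - k) (by omega)
    rw [hQm.leadingCoeff, one_mul, hdeg, Nat.sub_sub_self hk, hQ, Polynomial.coeff_map] at this
    rw [MvPolynomial.aeval_esymm_eq_multiset_esymm, hz, ← this]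
    simp
  obtain ⟨j, hj⟩ := exists_norm_one_sub_sq_lt z (fun j => hroot _ (hQroot (hmem j))) (N := N)
    fun k hk hkN => by
      refine sum_pow_eq_one_of_esymm z (m := N + 2) ?_ ?_ hk (by omega)
      · have := hesymm 1 (by omega)
        rw [h1] at this
        push_cast at this
        linear_combination this
      · intro k hk hkN
        have := hesymm k (by omega)
        rw [h0 k hk hkN, Int.cast_zero] at this
        exact (mul_eq_zero.1 this.symm).resolve_left (pow_ne_zero _ (by norm_num))
  exact ⟨z j, hQroot (hmem j), hj⟩

/-! ### Conclusion -/

theorem not_isCyclotomic_semigroupS {n t : ℕ} (h : 6 * t + 3 ≤ n)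
    (hn : 2 * (2 * t + 3) ^ 2 < n - 2 * t) : ¬ (semigroupS n t h).IsCyclotomic := by
  intro hcyc
  have hdeg := natDegree_polynomial_semigroupS h
  -- With this `N`, `2/(N+1) = 1/(2t+3)²` is the square of the lower bound `2/(c+4)` at `c = 4t+2`.
  obtain ⟨N, hN⟩ : ∃ N, 2 * (2 * t + 3) ^ 2 = N + 1 := ⟨2 * (2 * t + 3) ^ 2 - 1, by
    have : 0 < (2 * t + 3) ^ 2 := by positivity
    omega⟩
  obtain ⟨z, hz, hlt⟩ := exists_root_norm_one_sub_sq_lt (monic_polynomial_semigroupS h) hcyc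
    (N := N) (by omega) (by rw [hdeg, coeff_polynomial_semigroupS_two_mul_sub_one])
    fun k hk hkN => by rw [hdeg, coeff_polynomial_semigroupS_two_mul_sub h hk (by omega)]
  have heq := congrArg (Polynomial.aeval z) (polynomial_semigroupS_mul h)
  rw [map_mul, hz, mul_zero] at heq
  simp only [map_add, map_mul, map_sub, map_pow, map_one, Polynomial.aeval_X] at heq
  have h2 := two_le_mul_norm_one_sub (hcyc z hz) heq.symm
  have hN' : 2 * (2 * (t : ℝ) + 3) ^ 2 = N + 1 := by exact_mod_cast hN
  rw [← hN', lt_div_iff₀ (by positivity)] at hlt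
  push_cast at h2
  have h3 : 1 ≤ (2 * (t : ℝ) + 3) * ‖1 - z‖ := by linarith
  have h4 := one_le_pow₀ h3 (n := 2)
  rw [mul_pow] at h4
  linarith

/-- The complex roots of a product of cyclotomic polynomials lie on the unit circle. -/
theorem norm_eq_one_of_aeval_prod_cyclotomic_eq_zero {M : Multiset ℕ} (hM : ∀ m ∈ M, 1 ≤ m)
    {z : ℂ} (hz : Polynomial.aeval z (M.map fun m => Polynomial.cyclotomic m ℤ).prod = 0) :
    ‖z‖ = 1 := by
  rw [map_multiset_prod, Multiset.prod_eq_zero_iff, Multiset.map_map, Multiset.mem_map] at hz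
  obtain ⟨m, hm, hmz⟩ := hz
  have hm1 : m ≠ 0 := Nat.one_le_iff_ne_zero.1 (hM m hm)
  have : NeZero (m : ℂ) := ⟨Nat.cast_ne_zero.2 hm1⟩
  rw [Function.comp_apply, ← Polynomial.eval_map_algebraMap, Polynomial.map_cyclotomic] at hmz
  exact (Polynomial.isRoot_cyclotomic_iff.1 hmz).norm'_eq_one hm1

theorem size_bounds_of_max_le {n t : ℕ}
    (hn : max (8 * (t + 1) ^ 3) (40 * (t + 2)) ≤ n) :
    6 * t + 3 ≤ n ∧ 2 * (2 * t + 3) ^ 2 < n - 2 * t := by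
  obtain ⟨h1, h2⟩ := max_le_iff.1 hn
  refine ⟨by omega, ?_⟩
  suffices 2 * (2 * t + 3) ^ 2 + 2 * t < n by omega
  -- At `t = 0` the cubic gives only 8, but more than 18 is needed, so the linear bound is used; for
  -- `t ≥ 1` the cubic suffices.
  rcases t with _ | t
  · omega
  · nlinarith [Nat.zero_le (t ^ 3), Nat.zero_le (t ^ 2)]

/-- For `n ≥ max (8(t+1)^3, 40(t+2))` the submonoid `S_{n,t}` of `ℕ` generated by `generatorsS n t`
is a numerical semigroup of embedding dimension `n - 3t - 1`; it is symmetric but not cyclotomic,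
and its polynomial is not a product of cyclotomic polynomials `Φ_m`, `m ≥ 1`. -/
theorem theorem1 (t n : ℕ) (hn : max (8 * (t + 1) ^ 3) (40 * (t + 2)) ≤ n) :
    ∃ S : NumericalSemigroup,
      S.toAddSubmonoid = AddSubmonoid.closure (generatorsS n t) ∧
      S.embeddingDimension = n - 3 * t - 1 ∧
      S.IsSymmetric ∧
      ¬ S.IsCyclotomic ∧
      ¬ ∃ M : Multiset ℕ, (∀ m ∈ M, 1 ≤ m) ∧
        S.polynomial = (M.map fun m => Polynomial.cyclotomic m ℤ).prod := by
  obtain ⟨h, hlt⟩ := size_bounds_of_max_le hn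
  have hcyc := not_isCyclotomic_semigroupS h hlt
  have hmin := minimalGenerators_semigroupS h
  refine ⟨semigroupS n t h, ?_, ?_, isSymmetric_semigroupS h, hcyc, ?_⟩
  · rw [← hmin]
    exact (semigroupS n t h).isLeast_minimalGenerators.1.symm
  · rw [NumericalSemigroup.embeddingDimension, hmin, ncard_generatorsS h]
  · rintro ⟨M, hM, hPM⟩
    exact hcyc fun z hz => norm_eq_one_of_aeval_prod_cyclotomic_eq_zero hM (hPM ▸ hz)
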